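/- A path diagram (of secant type) consists of a Dyck path $u=u_1\cdots u_{2N}$ with steps northeast and southeast, together with integers $s_1,\dots,s_{2N}$ such that $0\le s_i\le j$ if $u_i$ is a northeast step starting at height $j$, and $0\le s_i\le k-1$ if $u_i$ is a southeast step starting at height $k$. Let $b_{N,m}$ be the number of path diagrams with Dyck path of length $2N$ and $\sum_i s_i=m$, and let $b^{(w)}_{N,m}$ be the number of those whose Dyck path does not exceed height $w$. Put $$G'(t,q)=\sum_{N,m\ge0}b_{N,m}\,t^{2N}q^m,\qquad G'_w(t,q)=\sum_{N,m\ge0}b^{(w)}_{N,m}\,t^{2N}q^m .$$ Let the $q$-secant numbers $E_{2N}(q)\in\mathbb Z[q]$ be defined by the formal continued fraction $$\sum_{N\ge0}E_{2N}(q)t^{2N}=\cfrac{1}{1-\cfrac{[1]_q^2t^2}{1-\cfrac{[2]_q^2t^2}{\ddots}}},\qquad [k]_q=1+q+\cdots+q^{k-1}.$$ Let $q\in\mathbb C$ with $|q|<1$, let $\sqrt q$ be either square root of $q$, and let $t\in\mathbb C$ with $0<|t|<(1-|q|)/2$. Let $\lambda$ be the root of smallest modulus of $\lambda^2-\lambda(1-q)/t+1=0$.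 Then all the series below converge (the double series for $G'$ and $G'_w$ absolutely), the denominators $1-i\lambda\sqrt q\,q^k$ do not vanish, and $$\sum_{N\ge0}E_{2N}(q)t^{2N}=G'(t,q)=\lim_{w\to\infty}G'_w(t,q)=(1+\lambda^2)\sum_{k=0}^\infty\frac{(-i\lambda\sqrt q)^k}{1-i\lambda\sqrt q\,q^k}.$$ -/

import Mathlib

/-- A possibility function: `pos U j` is the value at a northeast step starting at height `j`,
and `pos D k` the value at a southeast step starting at height `k`. -/
abbrev PossibilityFunction : Type := DyckStep → ℕ → ℕ

/-- The possibility function `pos(a_j) = j`, `pos(b_k) = k - 1`. A southeast step of a Dyck path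
starts at a height `k ≥ 1`, so the subtraction is never truncated where it is used. -/
def secantPos : PossibilityFunction
  | DyckStep.U, j => j
  | DyckStep.D, k => k - 1

/-- The height of a Dyck path after its first `i` steps (that is, at the start of the step with
index `i`, counted from `0`). No prefix of a Dyck word has more `D`s than `U`s, so the
subtraction is not truncated. -/
def dyckHeight (u : DyckWord) (i : ℕ) : ℕ :=
  (u.toList.take i).count DyckStep.U - (u.toList.take i).count DyckStep.D

/-- A path diagram for a possibility function: a Dyck path together with a column height `s i`,
`0 ≤ s i ≤ pos (u i)`, for each of its steps `u i`. -/
structure PathDiagram (pos : PossibilityFunction) where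
  /-- the Dyck path -/
  path : DyckWord
  /-- the column heights -/
  col : Fin path.toList.length → ℕ
  col_le : ∀ i, col i ≤ pos (path.toList.get i) (dyckHeight path i)

/-- The number of (unrestricted) path diagrams for `secantPos` whose Dyck path has length `2 * N`
and whose column heights sum to `m`. -/
noncomputable def secantCount (N m : ℕ) : ℕ :=
  Nat.card {d : PathDiagram secantPos // d.path.semilength = N ∧ ∑ i, d.col i = m}

/-- The number of such path diagrams in a slit of width `w`: the Dyck path never exceeds
height `w`. -/
noncomputable def secantCountSlit (w N m : ℕ) : ℕ :=
  Nat.card {d : PathDiagram secantPos //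
    d.path.semilength = N ∧ (∀ i, dyckHeight d.path i ≤ w) ∧ ∑ i, d.col i = m}

/-- The `q`-integer `[k]_q = 1 + q + ⋯ + q ^ (k - 1)`, as a polynomial in `q`. -/
noncomputable def qInteger (k : ℕ) : Polynomial ℤ :=
  ∑ i ∈ Finset.range k, Polynomial.X ^ i

/-- The finite continued fraction
`1 / (1 - [k+1]_q² t² / (1 - [k+2]_q² t² / (⋯ / (1 - [k+n]_q² t²))))`,
as a formal power series in `t` with coefficients in `ℤ[q]`. -/
noncomputable def secantFraction : ℕ → ℕ → PowerSeries (Polynomial ℤ)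
  | _, 0 => 1
  | k, n + 1 => PowerSeries.invOfUnit
      (1 - PowerSeries.C (qInteger (k + 1) ^ 2) * PowerSeries.X ^ 2 * secantFraction (k + 1) n) 1

theorem secantFraction_mul (k n : ℕ) :
    (1 - PowerSeries.C (qInteger (k + 1) ^ 2) * PowerSeries.X ^ 2 * secantFraction (k + 1) n) *
      secantFraction k (n + 1) = 1 := by
  rw [secantFraction]
  exact PowerSeries.mul_invOfUnit _ 1 (by simp)

theorem secantFraction_succ_sub (k n : ℕ) :
    (PowerSeries.X : PowerSeries (Polynomial ℤ)) ^ (2 * n + 2) ∣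
      secantFraction k (n + 1) - secantFraction k n := by
  induction n generalizing k with
  | zero =>
    have h := secantFraction_mul k 0
    refine ⟨PowerSeries.C (qInteger (k + 1) ^ 2) * secantFraction (k + 1) 0 *
      secantFraction k 1, ?_⟩
    simp only [secantFraction] at h ⊢
    linear_combination h
  | succ n ih =>
    have h1 := secantFraction_mul k n
    have h2 := secantFraction_mul k (n + 1)
    obtain ⟨c, hc⟩ := ih (k + 1)
    refine ⟨PowerSeries.C (qInteger (k + 1) ^ 2) * c *
      (secantFraction k (n + 1) * secantFraction k (n + 2)), ?_⟩
    linear_combination secantFraction k (n + 1) * h2 - secantFraction k (n + 2) * h1 +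
      PowerSeries.C (qInteger (k + 1) ^ 2) * PowerSeries.X ^ 2 *
        (secantFraction k (n + 1) * secantFraction k (n + 2)) * hc

/-- The coefficient of `t ^ (2 * N)` no longer changes from the `N`-th convergent on. -/
theorem coeff_secantFraction_stable (k N n : ℕ) (h : N ≤ n) :
    PowerSeries.coeff (2 * N) (secantFraction k n) =
      PowerSeries.coeff (2 * N) (secantFraction k N) := by
  induction n, h using Nat.le_induction with
  | base => rfl
  | succ n hn ih =>
    rw [← ih, ← sub_eq_zero, ← map_sub]
    exact PowerSeries.X_pow_dvd_iff.1 (secantFraction_succ_sub k n) _ (by omega)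

/-- The `q`-secant number `E_{2N}(q)`: the coefficient of `t ^ (2 * N)` in the infinite continued
fraction `1 / (1 - [1]_q² t² / (1 - [2]_q² t² / ⋯))`, which is its coefficient in every convergent
of depth at least `N`. -/
noncomputable def qSecantNumber (N : ℕ) : Polynomial ℤ :=
  PowerSeries.coeff (2 * N) (secantFraction 0 N)

/-- The generating function `G'_w(t, q) = ∑_{N, m} b^{(w)}_{N, m} t ^ (2 N) q ^ m` of path diagrams
in a slit of width `w` (used only where the double series converges absolutely). -/
noncomputable def secantSlitGF (w : ℕ) (t q : ℂ) : ℂ :=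
  ∑' p : ℕ × ℕ, (secantCountSlit w p.1 p.2 : ℂ) * t ^ (2 * p.1) * q ^ p.2

/-- The `k`-th term `(-iλ√q)^k / (1 - iλ√q q^k)`, where `s` stands for `√q`. -/
noncomputable def secantTerm (lam s q : ℂ) (k : ℕ) : ℂ :=
  (-Complex.I * lam * s) ^ k / (1 - Complex.I * lam * s * q ^ k)

/-! Choosing the column heights of a path diagram independently at each step gives every Dyck path
the weight ∏ [j+1]_q over its edges between heights j and j+1. All the series are thus governed by
weighted walks `walkSum`, taken over a general semiring so that the same facts serve for ℤ[q], q and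
|q|. Solving the first-step equations formally gives the continued fraction, as in Flajolet's theory
(`X_pow_dvd_walkSeries_sub`).

For the closed form, let G_h be the generating function of walks from h to 0, let A(x) = ∑ G_h x^h
and c = (1-q)/t. The first-step recurrence becomes (1 - cx + x²) A(x) = (1 + qx²) A(qx) - cx. At x =
λ the left side vanishes, which determines A(qλ); the points x = q^k λ then determine every A(q^k
λ), and G_0 = A(0) is their limit. With a = -iλ√q and b = iλ√q these values are (1+λ²) times
`lambertApprox`, whose limit L(b) satisfies L(b) = 1/(1-b) + a L(bq) (`lambertApprox_contiguous`,
`tendsto_lambertApprox`); iteration gives ∑ a^n/(1 - b q^n). -/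

/-- The weighted number of walks of length `n` from height `h` to height `0`, where the edge
between heights `j` and `j + 1` has weight `1 + q + ⋯ + q ^ j`. -/
def walkSum {R : Type*} [CommSemiring R] (q : R) : ℕ → ℕ → R
  | 0, h => if h = 0 then 1 else 0
  | n + 1, h => (∑ i ∈ Finset.range (h + 1), q ^ i) * walkSum q n (h + 1) +
      -- At height 0 the empty sum removes the down step, so the truncated `h - 1` is harmless.
      (∑ i ∈ Finset.range h, q ^ i) * walkSum q n (h - 1)

theorem map_walkSum {R S : Type*} [CommSemiring R] [CommSemiring S] (f : R →+* S) (q : R)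
    (n h : ℕ) : f (walkSum q n h) = walkSum (f q) n h := by
  induction n generalizing h with
  | zero => simp [walkSum, apply_ite f]
  | succ n ih => simp [walkSum, ih]

theorem walkSum_eq_zero_of_odd {R : Type*} [CommSemiring R] (q : R) (n h : ℕ)
    (hodd : Odd (n + h)) : walkSum q n h = 0 := by
  induction n generalizing h with
  | zero =>
    have : h ≠ 0 := by rintro rfl; simp at hodd
    simp [walkSum, this]
  | succ n ih =>
    rw [walkSum, ih (h + 1) (by rwa [← add_assoc, add_right_comm])]
    cases h with
    | zero => simp
    | succ h =>
      rw [Nat.add_sub_cancel, ih h]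
      · simp
      · rw [Nat.odd_iff] at hodd ⊢; omega

/-! ### Path diagrams as labelled walks -/

/-- Lists of steps with column heights that start at height `h`, end at height `0`, and respect
the possibility function `secantPos`. -/
def IsLabelledPath : ℕ → List (DyckStep × ℕ) → Prop
  | h, [] => h = 0
  | h, (DyckStep.U, s) :: L => s ≤ h ∧ IsLabelledPath (h + 1) L
  | h, (DyckStep.D, s) :: L => s < h ∧ IsLabelledPath (h - 1) L

/-- Bridges the step-by-step recursion and the prefix counts used by `DyckWord` and `dyckHeight`;
the induction needs an arbitrary starting height. -/
theorem isLabelledPath_iff (h : ℕ) (L : List (DyckStep × ℕ)) :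
    IsLabelledPath h L ↔
      (∀ i, ((L.map Prod.fst).take i).count DyckStep.D ≤
        h + ((L.map Prod.fst).take i).count DyckStep.U) ∧
      h + (L.map Prod.fst).count DyckStep.U = (L.map Prod.fst).count DyckStep.D ∧
      ∀ (i : ℕ) (hi : i < L.length), L[i].2 ≤ secantPos L[i].1
        (h + ((L.map Prod.fst).take i).count DyckStep.U -
          ((L.map Prod.fst).take i).count DyckStep.D) := by
  induction L generalizing h with
  | nil => simp [IsLabelledPath]
  | cons x L ih =>
    obtain ⟨u, s⟩ := x
    cases u with
    | U =>
      rw [IsLabelledPath, ih]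
      constructor
      · rintro ⟨h0, h1, h2, h3⟩
        refine ⟨fun i => ?_, ?_, fun i hi => ?_⟩
        · cases i with
          | zero => simp
          | succ i => have := h1 i; simp; omega
        · simp; omega
        · cases i with
          | zero => simpa [secantPos] using h0
          | succ i =>
            have := h3 i (by simpa using hi)
            simpa [add_assoc, add_comm, add_left_comm] using this
      · rintro ⟨h1, h2, h3⟩
        refine ⟨by have := h3 0 (by simp); simp at this; exact this, fun i => ?_, ?_, fun i hi => ?_⟩
        · have := h1 (i + 1); simp at this; omega
        · simp at h2; omega
        · have := h3 (i + 1) (by simpa using hi)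
          simpa [add_assoc, add_comm, add_left_comm] using this
    | D =>
      rw [IsLabelledPath, ih]
      constructor
      · rintro ⟨h0, h1, h2, h3⟩
        refine ⟨fun i => ?_, ?_, fun i hi => ?_⟩
        · cases i with
          | zero => simp
          | succ i => have := h1 i; simp; omega
        · simp; omega
        · cases i with
          | zero => simp [secantPos]; omega
          | succ i =>
            have := h3 i (by simpa using hi)
            simp only [List.map_cons, List.take_succ_cons, List.getElem_cons_succ,
              List.count_cons_self, List.count_cons_of_ne (show DyckStep.D ≠ DyckStep.U by decide)]
            convert this using 2
            omega
      · rintro ⟨h1, h2, h3⟩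
        -- The prefix of length 1 rules out a down step from height 0, where `secantPos` would
        -- truncate.
        have hpos : 1 ≤ h := by simpa using h1 1
        refine ⟨?_, fun i => ?_, ?_, fun i hi => ?_⟩
        · have := h3 0 (by simp)
          simp [secantPos] at this
          omega
        · have := h1 (i + 1); simp at this; omega
        · simp at h2; omega
        · have := h3 (i + 1) (by simpa using hi)
          simp only [List.map_cons, List.take_succ_cons, List.getElem_cons_succ,
            List.count_cons_self,
            List.count_cons_of_ne (show DyckStep.D ≠ DyckStep.U by decide)] at this
          convert this using 2
          omega

/-- The labelled paths of length `n` from height `h` to height `0`. -/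
def labelledPaths : ℕ → ℕ → Finset (List (DyckStep × ℕ))
  | 0, h => if h = 0 then {[]} else ∅
  | n + 1, h =>
    (Finset.range (h + 1) ×ˢ labelledPaths n (h + 1)).image
        (fun p => (DyckStep.U, p.1) :: p.2) ∪
      (Finset.range h ×ˢ labelledPaths n (h - 1)).image (fun p => (DyckStep.D, p.1) :: p.2)

theorem mem_labelledPaths (n h : ℕ) (L : List (DyckStep × ℕ)) :
    L ∈ labelledPaths n h ↔ L.length = n ∧ IsLabelledPath h L := by
  induction n generalizing h L with
  | zero =>
    by_cases hh : h = 0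
    · simp only [labelledPaths, hh, if_true, Finset.mem_singleton, List.length_eq_zero_iff]
      exact ⟨fun hL => ⟨hL, by simp [hL, IsLabelledPath]⟩, fun hL => hL.1⟩
    · simp only [labelledPaths, hh, if_false, Finset.notMem_empty, List.length_eq_zero_iff,
        false_iff]
      rintro ⟨rfl, hL⟩
      exact hh hL
  | succ n ih =>
    rcases L with _ | ⟨⟨u, s⟩, L⟩
    · simp [labelledPaths]
    · cases u <;> simp [labelledPaths, IsLabelledPath, ih, and_left_comm]

theorem sum_labelledPaths {R : Type*} [CommSemiring R] (q : R) (n h : ℕ) :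
    ∑ L ∈ labelledPaths n h, q ^ (L.map Prod.snd).sum = walkSum q n h := by
  induction n generalizing h with
  | zero => by_cases hh : h = 0 <;> simp [labelledPaths, walkSum, hh]
  | succ n ih =>
    rw [labelledPaths, Finset.sum_union, Finset.sum_image, Finset.sum_image,
      Finset.sum_product, Finset.sum_product]
    · simp only [List.map_cons, List.sum_cons, pow_add, ← Finset.mul_sum, ih, ← Finset.sum_mul,
        walkSum]
    · rintro ⟨a, b⟩ _ ⟨c, d⟩ _ h; simpa using h
    · rintro ⟨a, b⟩ _ ⟨c, d⟩ _ h; simpa using h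
    · rw [Finset.disjoint_left]
      intro L h1 h2
      simp only [Finset.mem_image] at h1 h2
      obtain ⟨p, -, rfl⟩ := h1
      obtain ⟨p', -, h⟩ := h2
      simp at h

/-- The list of steps and column heights of a path diagram. -/
def PathDiagram.toLabelledList {pos : PossibilityFunction} (d : PathDiagram pos) :
    List (DyckStep × ℕ) :=
  List.ofFn fun i => (d.path.toList.get i, d.col i)

theorem PathDiagram.map_fst_toLabelledList {pos : PossibilityFunction} (d : PathDiagram pos) :
    d.toLabelledList.map Prod.fst = d.path.toList := by
  simp [toLabelledList, List.map_ofFn, Function.comp_def]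

theorem PathDiagram.sum_map_snd_toLabelledList {pos : PossibilityFunction}
    (d : PathDiagram pos) : (d.toLabelledList.map Prod.snd).sum = ∑ i, d.col i := by
  simp [toLabelledList, List.map_ofFn, Function.comp_def, List.sum_ofFn]

theorem DyckWord.length_toList (u : DyckWord) : u.toList.length = 2 * u.semilength :=
  u.two_mul_semilength_eq_length.symm

theorem PathDiagram.length_toLabelledList {pos : PossibilityFunction} (d : PathDiagram pos) :
    d.toLabelledList.length = 2 * d.path.semilength := by
  rw [toLabelledList, List.length_ofFn, d.path.length_toList]

theorem PathDiagram.toLabelledList_injective {pos : PossibilityFunction} :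
    Function.Injective (PathDiagram.toLabelledList (pos := pos)) := by
  intro d e h
  have hp : d.path = e.path := by
    apply DyckWord.ext
    rw [← d.map_fst_toLabelledList, h, e.map_fst_toLabelledList]
  obtain ⟨p, c, hc⟩ := d
  obtain ⟨p', c', hc'⟩ := e
  obtain rfl : p = p' := hp
  have := List.ofFn_injective h
  congr
  funext i
  exact congrArg Prod.snd (congrFun this i)

theorem PathDiagram.isLabelledPath (d : PathDiagram secantPos) :
    IsLabelledPath 0 d.toLabelledList := by
  rw [isLabelledPath_iff, d.map_fst_toLabelledList]
  refine ⟨fun i => ?_, ?_, fun i hi => ?_⟩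
  · simpa using d.path.count_D_le_count_U i
  · simpa using d.path.count_U_eq_count_D
  · have := d.col_le ⟨i, by simpa [toLabelledList] using hi⟩
    simpa [toLabelledList, dyckHeight] using this

theorem PathDiagram.exists_toLabelledList_eq {L : List (DyckStep × ℕ)}
    (hL : IsLabelledPath 0 L) : ∃ d : PathDiagram secantPos, d.toLabelledList = L := by
  rw [isLabelledPath_iff] at hL
  obtain ⟨h1, h2, h3⟩ := hL
  refine ⟨⟨⟨L.map Prod.fst, by simpa using h2, fun i => by simpa using h1 i⟩,
    fun i => (L[(i : ℕ)]'(by simpa using i.2)).2, fun i => ?_⟩, ?_⟩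
  · simpa [dyckHeight] using h3 i (by simpa using i.2)
  · apply List.ext_getElem
    · simp [toLabelledList]
    · intro i _ _
      simp [toLabelledList]

/-- Path diagrams of semilength `N` and weight `m` correspond to labelled paths. -/
noncomputable def pathDiagramEquiv (N m : ℕ) :
    {d : PathDiagram secantPos // d.path.semilength = N ∧ ∑ i, d.col i = m} ≃
      {L // L ∈ (labelledPaths (2 * N) 0).filter fun L => (L.map Prod.snd).sum = m} :=
  Equiv.ofBijective
    (fun d => ⟨d.1.toLabelledList, by
      rw [Finset.mem_filter, mem_labelledPaths, d.1.length_toLabelledList, d.2.1,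
        d.1.sum_map_snd_toLabelledList]
      exact ⟨⟨rfl, d.1.isLabelledPath⟩, d.2.2⟩⟩)
    ⟨fun d e h => Subtype.ext (PathDiagram.toLabelledList_injective (congrArg Subtype.val h)), by
      rintro ⟨L, hL⟩
      rw [Finset.mem_filter, mem_labelledPaths] at hL
      obtain ⟨⟨hl, hp⟩, hs⟩ := hL
      obtain ⟨d, rfl⟩ := PathDiagram.exists_toLabelledList_eq hp
      rw [d.length_toLabelledList] at hl
      rw [d.sum_map_snd_toLabelledList] at hs
      exact ⟨⟨d, by omega, hs⟩, rfl⟩⟩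

theorem secantCount_eq_card (N m : ℕ) : secantCount N m =
    ((labelledPaths (2 * N) 0).filter fun L => (L.map Prod.snd).sum = m).card := by
  rw [secantCount, Nat.card_congr (pathDiagramEquiv N m), Nat.card_eq_fintype_card,
    Fintype.card_coe]

theorem hasSum_card_filter_mul_pow {α : Type*} {R : Type*} [CommSemiring R] [TopologicalSpace R]
    [ContinuousAdd R] (S : Finset α) (f : α → ℕ) (q : R) :
    HasSum (fun m => ((S.filter fun x => f x = m).card : R) * q ^ m) (∑ x ∈ S, q ^ f x) := by
  have h := hasSum_sum (s := S) fun x _ => hasSum_ite_eq (f x) (q ^ f x)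
  convert h using 2 with m
  rw [Finset.card_filter, Nat.cast_sum, Finset.sum_mul]
  refine Finset.sum_congr rfl fun x _ => ?_
  by_cases hx : f x = m
  · simp [hx]
  · simp [hx, Ne.symm hx]

theorem hasSum_secantCount {R : Type*} [CommSemiring R] [TopologicalSpace R]
    [ContinuousAdd R] (N : ℕ) (q : R) :
    HasSum (fun m => (secantCount N m : R) * q ^ m) (walkSum q (2 * N) 0) := by
  simp only [secantCount_eq_card, ← sum_labelledPaths]
  exact hasSum_card_filter_mul_pow _ _ q

theorem secantCountSlit_le (w N m : ℕ) : secantCountSlit w N m ≤ secantCount N m := by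
  -- Finiteness is essential: `Nat.card` of an infinite type is 0.
  have := Finite.of_equiv _ (pathDiagramEquiv N m).symm
  exact Nat.card_le_card_of_injective
    (fun d => (⟨d.1, d.2.1, d.2.2.2⟩ :
      {d : PathDiagram secantPos // d.path.semilength = N ∧ ∑ i, d.col i = m}))
    fun d e h => Subtype.ext (Subtype.mk.inj h)

/-- A path with N up steps never rises above N. -/
theorem secantCountSlit_eq (w N m : ℕ) (h : N ≤ w) : secantCountSlit w N m = secantCount N m := by
  refine Nat.card_congr (Equiv.subtypeEquivRight fun d => ?_)
  refine ⟨fun hd => ⟨hd.1, hd.2.2⟩, fun hd => ⟨hd.1, fun i => ?_, hd.2⟩⟩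
  calc dyckHeight d.path i ≤ (d.path.toList.take i).count DyckStep.U := Nat.sub_le _ _
    _ ≤ d.path.toList.count DyckStep.U := (List.take_sublist _ _).count_le _
    _ = N := hd.1
    _ ≤ w := h

/-! ### The formal continued fraction -/

/-- The generating function, by length, of walks from height `h` to height `0`. -/
noncomputable def walkSeries (h : ℕ) : PowerSeries (Polynomial ℤ) :=
  PowerSeries.mk fun n => walkSum Polynomial.X n h

theorem walkSeries_eq (h : ℕ) : walkSeries h = (if h = 0 then 1 else 0) +
    PowerSeries.X * (PowerSeries.C (qInteger (h + 1)) * walkSeries (h + 1) +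
      PowerSeries.C (qInteger h) * walkSeries (h - 1)) := by
  ext1 n
  cases n with
  | zero => by_cases hh : h = 0 <;> simp [walkSeries, walkSum, hh]
  | succ n =>
    have : PowerSeries.coeff (n + 1) (if h = 0 then 1 else 0 : PowerSeries (Polynomial ℤ)) = 0 := by
      split_ifs <;> simp [PowerSeries.coeff_one]
    rw [map_add, this, PowerSeries.coeff_succ_X_mul, map_add, PowerSeries.coeff_C_mul,
      PowerSeries.coeff_C_mul]
    simp [walkSeries, walkSum, qInteger]

/-- A walk from h+1 to 0 splits at its first visit to h, and the part before the final down step is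
counted by the continued fraction. Algebraically, the approximation at h+2 is inserted into the
first-step equation at h+1, which gains one power of `X`. -/
theorem X_pow_dvd_walkSeries_sub (n h : ℕ) :
    (PowerSeries.X : PowerSeries (Polynomial ℤ)) ^ (n + 1) ∣ walkSeries (h + 1) -
      PowerSeries.C (qInteger (h + 1)) * PowerSeries.X * secantFraction (h + 1) n *
        walkSeries h := by
  induction n generalizing h with
  | zero =>
    have h1 := walkSeries_eq (h + 1)
    rw [if_neg h.succ_ne_zero] at h1
    rw [h1]
    refine ⟨PowerSeries.C (qInteger (h + 1 + 1)) * walkSeries (h + 1 + 1) +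
      PowerSeries.C (qInteger (h + 1)) * walkSeries (h + 1 - 1) -
      PowerSeries.C (qInteger (h + 1)) * secantFraction (h + 1) 0 * walkSeries h, ?_⟩
    ring
  | succ n ih =>
    obtain ⟨c, hc⟩ := ih (h + 1)
    have h1 := walkSeries_eq (h + 1)
    rw [if_neg h.succ_ne_zero, Nat.add_sub_cancel] at h1
    have h2 := secantFraction_mul (h + 1) n
    rw [map_pow] at h2
    refine ⟨PowerSeries.C (qInteger (h + 1 + 1)) * secantFraction (h + 1) (n + 1) * c, ?_⟩
    linear_combination (secantFraction (h + 1) (n + 1)) * h1 - walkSeries (h + 1) * h2 +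
      PowerSeries.X * PowerSeries.C (qInteger (h + 1 + 1)) *
        secantFraction (h + 1) (n + 1) * hc

theorem X_pow_dvd_walkSeries_zero_sub (n : ℕ) :
    (PowerSeries.X : PowerSeries (Polynomial ℤ)) ^ (n + 1) ∣
      walkSeries 0 - secantFraction 0 (n + 1) := by
  obtain ⟨c, hc⟩ := X_pow_dvd_walkSeries_sub n 0
  have h1 := walkSeries_eq 0
  have h0 : qInteger 0 = 0 := by simp [qInteger]
  rw [if_pos rfl, h0, map_zero, zero_mul, add_zero] at h1
  have h2 := secantFraction_mul 0 n
  rw [map_pow] at h2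
  refine ⟨PowerSeries.C (qInteger (0 + 1)) * PowerSeries.X * secantFraction 0 (n + 1) * c, ?_⟩
  linear_combination (secantFraction 0 (n + 1)) * h1 - walkSeries 0 * h2 +
      PowerSeries.X * PowerSeries.C (qInteger (0 + 1)) *
        secantFraction 0 (n + 1) * hc

theorem qSecantNumber_eq_walkSum (N : ℕ) :
    qSecantNumber N = walkSum Polynomial.X (2 * N) 0 := by
  -- Depth 2N+1 gives agreement modulo X^(2N+1), enough for the coefficient of X^(2N).
  rw [qSecantNumber, ← coeff_secantFraction_stable 0 N (2 * N + 1) (by omega)]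
  have := PowerSeries.X_pow_dvd_iff.1 (X_pow_dvd_walkSeries_zero_sub (2 * N)) (2 * N) (by omega)
  rw [map_sub, sub_eq_zero] at this
  rw [← this, walkSeries, PowerSeries.coeff_mk]

theorem aeval_qSecantNumber {R : Type*} [CommRing R] (q : R) (N : ℕ) :
    Polynomial.aeval q (qSecantNumber N) = walkSum q (2 * N) 0 := by
  rw [qSecantNumber_eq_walkSum]
  have := map_walkSum (Polynomial.aeval (R := ℤ) q).toRingHom Polynomial.X (2 * N) 0
  simpa using this

/-! ### The recurrence whose limit is ∑ a^n/(1 - b q^n) -/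

/-- The partial sums of a `q`-hypergeometric series whose sum is `∑ a ^ n / (1 - b * q ^ n)`,
given by their recurrence. -/
noncomputable def lambertApprox (q a b : ℂ) : ℕ → ℂ
  | 0 => 1 / ((1 - a) * (1 - b))
  | k + 1 => ((1 - q ^ (k + 1)) * (1 - a * b * q ^ k) * lambertApprox q a b k + q ^ (k + 1)) /
      ((1 - a * q ^ (k + 1)) * (1 - b * q ^ (k + 1)))

theorem one_sub_mul_pow_ne_zero {q a : ℂ} (hq : ‖q‖ ≤ 1) (ha : ‖a‖ < 1) (k : ℕ) :
    1 - a * q ^ k ≠ 0 := by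
  intro h
  have h1 : ‖a * q ^ k‖ ≤ ‖a‖ := by
    rw [norm_mul, norm_pow]
    exact mul_le_of_le_one_right (norm_nonneg _) (pow_le_one₀ (norm_nonneg _) hq)
  rw [← sub_eq_zero.1 h, norm_one] at h1
  linarith

theorem lambertApprox_contiguous {q a b : ℂ} (hq : ‖q‖ ≤ 1) (ha : ‖a‖ < 1) (hb : ‖b‖ < 1)
    (k : ℕ) : (1 - a * b * q ^ k) * lambertApprox q a b k -
      a * (1 - b * q ^ (k + 1)) * lambertApprox q a (b * q) k = 1 / (1 - b) := by
  have hb0 := one_sub_mul_pow_ne_zero hq hb 0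
  have ha0 := one_sub_mul_pow_ne_zero hq ha 0
  rw [pow_zero, mul_one] at hb0 ha0
  induction k with
  | zero =>
    have hb1 := one_sub_mul_pow_ne_zero hq hb 1
    rw [pow_one] at hb1
    simp only [lambertApprox, pow_zero, zero_add, pow_one, mul_one]
    field_simp
    ring
  | succ k ih =>
    have hak := one_sub_mul_pow_ne_zero hq ha (k + 1)
    have hbk := one_sub_mul_pow_ne_zero hq hb (k + 1)
    have hbk' := one_sub_mul_pow_ne_zero hq hb (k + 1 + 1)
    have e : b * q * q ^ (k + 1) = b * q ^ (k + 1 + 1) := by ring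
    have e' : a * (b * q) * q ^ k = a * b * q ^ (k + 1) := by ring
    rw [lambertApprox, lambertApprox, e, e']
    generalize lambertApprox q a b k = z at *
    generalize lambertApprox q a (b * q) k = z' at *
    -- The factor 1 - b q^(k+2) cancels, leaving exactly the relation at level k inside the bracket.
    have h1 : (1 - a * b * q ^ (k + 1)) * (((1 - q ^ (k + 1)) * (1 - a * b * q ^ k) * z +
        q ^ (k + 1)) / ((1 - a * q ^ (k + 1)) * (1 - b * q ^ (k + 1)))) -
        a * (1 - b * q ^ (k + 1 + 1)) * (((1 - q ^ (k + 1)) * (1 - a * b * q ^ (k + 1)) * z' +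
        q ^ (k + 1)) / ((1 - a * q ^ (k + 1)) * (1 - b * q ^ (k + 1 + 1)))) =
        ((1 - a * b * q ^ (k + 1)) * (1 - q ^ (k + 1)) * ((1 - a * b * q ^ k) * z -
          a * (1 - b * q ^ (k + 1)) * z') + q ^ (k + 1) * (1 - a)) /
          ((1 - a * q ^ (k + 1)) * (1 - b * q ^ (k + 1))) := by
      generalize q ^ (k + 1 + 1) = Q' at *
      generalize q ^ (k + 1) = Q at *
      generalize q ^ k = P at *
      field_simp
      ring
    rw [h1, ih]
    generalize q ^ (k + 1) = Q at *
    field_simp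
    ring

theorem norm_lambertApprox_succ_le {q a b : ℂ} {ρ : ℝ} (hq : ‖q‖ < 1) (hρ : ρ < 1)
    (ha : ‖a‖ ≤ ρ) (hb : ‖b‖ ≤ ρ) (k : ℕ) :
    ‖lambertApprox q a b (k + 1)‖ + 1 ≤
      (1 + 6 * ‖q‖ ^ k / (1 - ρ) ^ 2) * (‖lambertApprox q a b k‖ + 1) := by
  have hk0 : 0 ≤ ‖q‖ ^ k := by positivity
  have hk1 : ‖q‖ ^ k ≤ 1 := pow_le_one₀ (norm_nonneg _) hq.le
  have hQ : ‖q ^ (k + 1)‖ ≤ ‖q‖ ^ k := by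
    rw [norm_pow, pow_succ]
    exact mul_le_of_le_one_right hk0 hq.le
  have hp : ‖a * b * q ^ k‖ ≤ ‖q‖ ^ k := by
    rw [norm_mul, norm_mul, norm_pow]
    exact mul_le_of_le_one_left hk0
      (mul_le_one₀ (ha.trans hρ.le) (norm_nonneg _) (hb.trans hρ.le))
  rw [lambertApprox]
  generalize lambertApprox q a b k = z
  generalize a * b * q ^ k = p at *
  generalize q ^ (k + 1) = Q at *
  generalize ‖q‖ ^ k = ε at *
  have hδ : 0 < (1 - ρ) ^ 2 := by
    have : 0 < 1 - ρ := by linarith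
    positivity
  have hmul : ∀ c : ℂ, ‖c‖ ≤ ρ → ‖c * Q‖ ≤ ε ∧ ‖c * Q‖ ≤ ρ ∧ 1 - ρ ≤ ‖1 - c * Q‖ := by
    intro c hc
    have h0 : ‖c * Q‖ ≤ ρ := by
      rw [norm_mul]
      exact (mul_le_of_le_one_right (norm_nonneg _) (hQ.trans hk1)).trans hc
    refine ⟨?_, h0, ?_⟩
    · rw [norm_mul]
      exact (mul_le_of_le_one_left (norm_nonneg _) (hc.trans hρ.le)).trans hQ
    · have := norm_sub_norm_le (1 : ℂ) (c * Q)
      rw [norm_one] at this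
      linarith
  obtain ⟨ha1, ha2, ha3⟩ := hmul a ha
  obtain ⟨hb1, hb2, hb3⟩ := hmul b hb
  have hD : (1 - ρ) ^ 2 ≤ ‖(1 - a * Q) * (1 - b * Q)‖ := by
    rw [norm_mul, sq]
    exact mul_le_mul ha3 hb3 (by linarith) (norm_nonneg _)
  -- The two products differ by aQ, bQ, abQ², Q, p and pQ: six terms, each of norm at most ε.
  have hN : ‖(1 - Q) * (1 - p)‖ ≤ ‖(1 - a * Q) * (1 - b * Q)‖ + 6 * ε := by
    have e : (1 - Q) * (1 - p) = (1 - a * Q) * (1 - b * Q) +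
        (((a * Q + b * Q) - (a * Q) * (b * Q)) - (Q + p * (1 - Q))) := by ring
    have h1 : ‖(a * Q) * (b * Q)‖ ≤ ε := by
      rw [norm_mul]
      exact (mul_le_of_le_one_left (norm_nonneg _) (ha2.trans hρ.le)).trans hb1
    have h2 : ‖Q + p * (1 - Q)‖ = ‖Q + p - p * Q‖ := by congr 1; ring
    have h3 : ‖p * Q‖ ≤ ε := by
      rw [norm_mul]
      exact (mul_le_of_le_one_left (norm_nonneg _) (hp.trans hk1)).trans hQ
    have h4 := norm_add_le ((1 - a * Q) * (1 - b * Q))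
      (((a * Q + b * Q) - (a * Q) * (b * Q)) - (Q + p * (1 - Q)))
    have h5 := norm_sub_le ((a * Q + b * Q) - (a * Q) * (b * Q)) (Q + p * (1 - Q))
    have h6 := norm_sub_le (a * Q + b * Q) ((a * Q) * (b * Q))
    have h7 := norm_add_le (a * Q) (b * Q)
    have h8 := norm_sub_le (Q + p) (p * Q)
    have h9 := norm_add_le Q p
    rw [e]
    linarith
  generalize (1 - ρ) ^ 2 = δ at *
  generalize (1 - a * Q) * (1 - b * Q) = D at *
  have hD0 : 0 < ‖D‖ := hδ.trans_le hD
  have h1 : ‖((1 - Q) * (1 - p) * z + Q) / D‖ ≤ (1 + 6 * ε / δ) * ‖z‖ + ε / δ := by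
    rw [norm_div, div_le_iff₀ hD0]
    have h2 : ‖(1 - Q) * (1 - p) * z + Q‖ ≤ (‖D‖ + 6 * ε) * ‖z‖ + ε := by
      refine (norm_add_le _ _).trans (add_le_add ?_ hQ)
      rw [norm_mul]
      gcongr
    have h3 : ε ≤ ε / δ * ‖D‖ := by
      rw [div_mul_eq_mul_div, le_div_iff₀ hδ]
      gcongr
    calc _ ≤ _ := h2
      _ ≤ (‖D‖ + 6 * (ε / δ * ‖D‖)) * ‖z‖ + ε / δ * ‖D‖ := by gcongr
      _ = _ := by ring
  have h4 : 0 ≤ ε / δ := by positivity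
  have h5 : 0 ≤ ε / δ * ‖z‖ := by positivity
  rw [mul_div_assoc] at h1 ⊢
  nlinarith

/-- The growth factors 1 + O(|q|^k) have a bounded product. Uniformity in b matters because the
expansion replaces b by b q^n. -/
theorem exists_bound_lambertApprox {q a : ℂ} {ρ : ℝ} (hq : ‖q‖ < 1) (hρ : ρ < 1)
    (ha : ‖a‖ ≤ ρ) : ∃ C, ∀ b : ℂ, ‖b‖ ≤ ρ → ∀ k, ‖lambertApprox q a b k‖ ≤ C := by
  have hρ1 : 0 < 1 - ρ := by linarith
  refine ⟨(1 / (1 - ρ) ^ 2 + 1) * Real.exp (6 * (1 - ‖q‖)⁻¹ / (1 - ρ) ^ 2), fun b hb k => ?_⟩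
  have h : ‖lambertApprox q a b k‖ + 1 ≤ (1 / (1 - ρ) ^ 2 + 1) *
      Real.exp (∑ j ∈ Finset.range k, 6 * ‖q‖ ^ j / (1 - ρ) ^ 2) := by
    induction k with
    | zero =>
      have h1 : ∀ c : ℂ, ‖c‖ ≤ ρ → 1 - ρ ≤ ‖1 - c‖ := by
        intro c hc
        have := norm_sub_norm_le (1 : ℂ) c
        rw [norm_one] at this
        linarith
      have h2 : (1 - ρ) ^ 2 ≤ ‖(1 - a) * (1 - b)‖ := by
        rw [norm_mul, sq]
        exact mul_le_mul (h1 a ha) (h1 b hb) hρ1.le (norm_nonneg _)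
      simp only [lambertApprox, Finset.range_zero, Finset.sum_empty, Real.exp_zero, mul_one]
      rw [norm_div, norm_one]
      gcongr
    | succ k ih =>
      rw [Finset.sum_range_succ, Real.exp_add]
      have h1 := Real.add_one_le_exp (6 * ‖q‖ ^ k / (1 - ρ) ^ 2)
      calc _ ≤ _ := norm_lambertApprox_succ_le hq hρ ha hb k
        _ ≤ Real.exp (6 * ‖q‖ ^ k / (1 - ρ) ^ 2) * ((1 / (1 - ρ) ^ 2 + 1) *
            Real.exp (∑ j ∈ Finset.range k, 6 * ‖q‖ ^ j / (1 - ρ) ^ 2)) := by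
          gcongr
          linarith
        _ = _ := by ring
  have h2 : ∑ j ∈ Finset.range k, 6 * ‖q‖ ^ j / (1 - ρ) ^ 2 ≤
      6 * (1 - ‖q‖)⁻¹ / (1 - ρ) ^ 2 := by
    rw [← Finset.sum_div, ← Finset.mul_sum, ← tsum_geometric_of_lt_one (norm_nonneg q) hq]
    gcongr
    exact (summable_geometric_of_lt_one (norm_nonneg q) hq).sum_le_tsum _
      fun _ _ => by positivity
  have h3 : (1 / (1 - ρ) ^ 2 + 1) *
      Real.exp (∑ j ∈ Finset.range k, 6 * ‖q‖ ^ j / (1 - ρ) ^ 2) ≤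
      (1 / (1 - ρ) ^ 2 + 1) * Real.exp (6 * (1 - ‖q‖)⁻¹ / (1 - ρ) ^ 2) := by
    gcongr
  linarith

theorem norm_pow_div_one_sub_le {q a b : ℂ} (hq : ‖q‖ ≤ 1) (hb : ‖b‖ < 1) (n : ℕ) :
    ‖a ^ n / (1 - b * q ^ n)‖ ≤ ‖a‖ ^ n * (1 - ‖b‖)⁻¹ := by
  have h1 : ‖b * q ^ n‖ ≤ ‖b‖ := by
    rw [norm_mul, norm_pow]
    exact mul_le_of_le_one_right (norm_nonneg _) (pow_le_one₀ (norm_nonneg _) hq)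
  have h2 := norm_sub_norm_le (1 : ℂ) (b * q ^ n)
  rw [norm_one] at h2
  rw [norm_div, norm_pow, div_eq_mul_inv]
  gcongr
  linarith

theorem summable_pow_div_one_sub {q a b : ℂ} (hq : ‖q‖ ≤ 1) (ha : ‖a‖ < 1) (hb : ‖b‖ < 1) :
    Summable fun n : ℕ => a ^ n / (1 - b * q ^ n) :=
  .of_norm_bounded ((summable_geometric_of_lt_one (norm_nonneg a) ha).mul_right _)
    fun n => norm_pow_div_one_sub_le hq hb n

/-- Dropping the q^k terms from the contiguous relation costs at most 2C|q|^k. Iterating n times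
multiplies these errors by powers of |a|, so letting n → ∞ at fixed k leaves a total error O(|q|^k).
-/
theorem tendsto_lambertApprox {q a b : ℂ} (hq : ‖q‖ < 1) (ha : ‖a‖ < 1) (hb : ‖b‖ < 1) :
    Filter.Tendsto (lambertApprox q a b) Filter.atTop
      (nhds (∑' n : ℕ, a ^ n / (1 - b * q ^ n))) := by
  obtain ⟨C, hC⟩ := exists_bound_lambertApprox hq (max_lt ha hb) (le_max_left ‖a‖ ‖b‖)
  have hbn : ∀ n : ℕ, ‖b * q ^ n‖ ≤ ‖b‖ := fun n => by
    rw [norm_mul, norm_pow]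
    exact mul_le_of_le_one_right (norm_nonneg _) (pow_le_one₀ (norm_nonneg _) hq.le)
  have hC' : ∀ n k, ‖lambertApprox q a (b * q ^ n) k‖ ≤ C :=
    fun n k => hC _ ((hbn n).trans (le_max_right _ _)) k
  have hC0 : 0 ≤ C := (norm_nonneg _).trans (hC' 0 0)
  -- one step of the expansion in powers of `a`
  have hstep : ∀ n k, ‖lambertApprox q a (b * q ^ n) k - a * lambertApprox q a (b * q ^ (n + 1)) k
      - 1 / (1 - b * q ^ n)‖ ≤ 2 * C * ‖q‖ ^ k := by
    intro n k
    rw [← lambertApprox_contiguous hq.le ha ((hbn n).trans_lt hb) k,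
      show b * q ^ (n + 1) = b * q ^ n * q by ring]
    have e : ∀ z w : ℂ, z - a * w - ((1 - a * (b * q ^ n) * q ^ k) * z -
        a * (1 - b * q ^ n * q ^ (k + 1)) * w) =
        q ^ k * ((a * (b * q ^ n)) * z - (a * (b * q ^ n) * q) * w) := fun z w => by ring
    rw [e, norm_mul, norm_pow, mul_comm]
    gcongr
    have h1 : ‖a * (b * q ^ n)‖ ≤ 1 := by
      rw [norm_mul]
      exact mul_le_one₀ ha.le (norm_nonneg _) ((hbn n).trans hb.le)
    have h2 : ‖a * (b * q ^ n) * q‖ ≤ 1 := by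
      rw [norm_mul]
      exact mul_le_one₀ h1 (norm_nonneg _) hq.le
    refine (norm_sub_le _ _).trans ?_
    rw [norm_mul, norm_mul _ (lambertApprox _ _ _ _)]
    have h3 := mul_le_mul h1 (hC' n k) (norm_nonneg _) zero_le_one
    have h4 := mul_le_mul h2 (hC' (n + 1) k) (norm_nonneg _) zero_le_one
    rw [show b * q ^ (n + 1) = b * q ^ n * q by ring] at h4
    linarith
  have hiter : ∀ k n, ‖lambertApprox q a b k - ∑ j ∈ Finset.range n, a ^ j / (1 - b * q ^ j)‖ ≤
      ‖a‖ ^ n * C + (∑ j ∈ Finset.range n, ‖a‖ ^ j) * (2 * C * ‖q‖ ^ k) := by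
    intro k n
    have key : ‖lambertApprox q a b k - ∑ j ∈ Finset.range n, a ^ j / (1 - b * q ^ j) -
        a ^ n * lambertApprox q a (b * q ^ n) k‖ ≤
        (∑ j ∈ Finset.range n, ‖a‖ ^ j) * (2 * C * ‖q‖ ^ k) := by
      induction n with
      | zero => simp
      | succ n ih =>
        rw [Finset.sum_range_succ, Finset.sum_range_succ, add_mul]
        have e : lambertApprox q a b k - (∑ j ∈ Finset.range n, a ^ j / (1 - b * q ^ j) +
            a ^ n / (1 - b * q ^ n)) - a ^ (n + 1) * lambertApprox q a (b * q ^ (n + 1)) k =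
            (lambertApprox q a b k - ∑ j ∈ Finset.range n, a ^ j / (1 - b * q ^ j) -
              a ^ n * lambertApprox q a (b * q ^ n) k) +
            a ^ n * (lambertApprox q a (b * q ^ n) k -
              a * lambertApprox q a (b * q ^ (n + 1)) k - 1 / (1 - b * q ^ n)) := by ring
        rw [e]
        refine (norm_add_le _ _).trans (add_le_add ih ?_)
        rw [norm_mul, norm_pow]
        gcongr
        exact hstep n k
    have h1 := norm_add_le (lambertApprox q a b k -
      ∑ j ∈ Finset.range n, a ^ j / (1 - b * q ^ j) - a ^ n * lambertApprox q a (b * q ^ n) k)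
      (a ^ n * lambertApprox q a (b * q ^ n) k)
    rw [sub_add_cancel] at h1
    have h2 : ‖a ^ n * lambertApprox q a (b * q ^ n) k‖ ≤ ‖a‖ ^ n * C := by
      rw [norm_mul, norm_pow]
      gcongr
      exact hC' n k
    linarith
  have hlim : ∀ k, ‖lambertApprox q a b k - ∑' n : ℕ, a ^ n / (1 - b * q ^ n)‖ ≤
      (1 - ‖a‖)⁻¹ * (2 * C * ‖q‖ ^ k) := by
    intro k
    have h1 := ((tendsto_const_nhds (x := lambertApprox q a b k)).sub
      (summable_pow_div_one_sub hq.le ha hb).hasSum.tendsto_sum_nat).norm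
    have h2 := ((tendsto_pow_atTop_nhds_zero_of_lt_one (norm_nonneg a) ha).mul_const C).add
      ((hasSum_geometric_of_lt_one (norm_nonneg a) ha).tendsto_sum_nat.mul_const
        (2 * C * ‖q‖ ^ k))
    rw [zero_mul, zero_add] at h2
    exact le_of_tendsto_of_tendsto' h1 h2 (hiter k)
  rw [tendsto_iff_norm_sub_tendsto_zero]
  refine squeeze_zero (fun _ => norm_nonneg _) hlim ?_
  simpa using ((tendsto_pow_atTop_nhds_zero_of_lt_one (norm_nonneg q) hq).const_mul
    (2 * C)).const_mul (1 - ‖a‖)⁻¹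

/-! ### Convergence of the walk generating functions -/

theorem norm_geom_sum_le {𝕜 : Type*} [NormedField 𝕜] {q : 𝕜} (hq : ‖q‖ < 1) (h : ℕ) :
    ‖∑ i ∈ Finset.range h, q ^ i‖ ≤ (1 - ‖q‖)⁻¹ := by
  rw [← tsum_geometric_of_lt_one (norm_nonneg q) hq]
  refine (norm_sum_le _ _).trans ?_
  simp only [norm_pow]
  exact (summable_geometric_of_lt_one (norm_nonneg q) hq).sum_le_tsum _
    fun _ _ => by positivity

/-- Two choices per step, each edge weighing at most 1/(1-|q|); this is the source of the condition
|t| < (1-|q|)/2. -/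
theorem norm_walkSum_le {𝕜 : Type*} [NormedField 𝕜] {q : 𝕜} (hq : ‖q‖ < 1) (n h : ℕ) :
    ‖walkSum q n h‖ ≤ (2 * (1 - ‖q‖)⁻¹) ^ n := by
  have h1 : 0 ≤ (1 - ‖q‖)⁻¹ := inv_nonneg.2 (by linarith)
  induction n generalizing h with
  | zero => by_cases hh : h = 0 <;> simp [walkSum, hh]
  | succ n ih =>
    rw [walkSum]
    refine (norm_add_le _ _).trans ?_
    rw [norm_mul, norm_mul]
    have h2 := mul_le_mul (norm_geom_sum_le hq (h + 1)) (ih (h + 1)) (norm_nonneg _) h1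
    have h3 := mul_le_mul (norm_geom_sum_le hq h) (ih (h - 1)) (norm_nonneg _) h1
    calc _ ≤ _ := add_le_add h2 h3
      _ = _ := by ring

theorem norm_walkSum_mul_pow_le {𝕜 : Type*} [NormedField 𝕜] {q : 𝕜} (hq : ‖q‖ < 1) (t : 𝕜)
    (n h : ℕ) : ‖walkSum q n h * t ^ n‖ ≤ (2 * (1 - ‖q‖)⁻¹ * ‖t‖) ^ n := by
  rw [norm_mul, norm_pow, mul_pow]
  gcongr
  exact norm_walkSum_le hq n h

theorem walk_ratio_lt_one {r τ : ℝ} (hr : r < 1) (hτ : τ < (1 - r) / 2) :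
    2 * (1 - r)⁻¹ * τ < 1 := by
  have h : 0 < 1 - r := by linarith
  rw [mul_comm 2, mul_assoc, inv_mul_lt_iff₀ h]
  linarith

/-- The sum over all walks from height `h` to height `0`, weighted by `t` to the length. -/
noncomputable def walkGF (q t : ℂ) (h : ℕ) : ℂ := ∑' n, walkSum q n h * t ^ n

section

variable {q t : ℂ}

theorem walkGF_ratio_nonneg (hq : ‖q‖ < 1) : 0 ≤ 2 * (1 - ‖q‖)⁻¹ * ‖t‖ := by
  have h1 : 0 ≤ (1 - ‖q‖)⁻¹ := inv_nonneg.2 (by linarith)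
  positivity

theorem summable_walkGF (hq : ‖q‖ < 1) (ht : ‖t‖ < (1 - ‖q‖) / 2) (h : ℕ) :
    Summable fun n => walkSum q n h * t ^ n :=
  .of_norm_bounded
    (summable_geometric_of_lt_one (walkGF_ratio_nonneg hq) (walk_ratio_lt_one hq ht))
    fun n => norm_walkSum_mul_pow_le hq t n h

theorem norm_walkGF_le (hq : ‖q‖ < 1) (ht : ‖t‖ < (1 - ‖q‖) / 2) (h : ℕ) :
    ‖walkGF q t h‖ ≤ (1 - 2 * (1 - ‖q‖)⁻¹ * ‖t‖)⁻¹ :=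
  tsum_of_norm_bounded
    (hasSum_geometric_of_lt_one (walkGF_ratio_nonneg hq) (walk_ratio_lt_one hq ht))
    fun n => norm_walkSum_mul_pow_le hq t n h

theorem walkGF_recurrence (hq : ‖q‖ < 1) (ht : ‖t‖ < (1 - ‖q‖) / 2) (h : ℕ) :
    (1 - q) * (walkGF q t h - if h = 0 then 1 else 0) =
      t * ((1 - q ^ (h + 1)) * walkGF q t (h + 1) + (1 - q ^ h) * walkGF q t (h - 1)) := by
  have h1 : walkGF q t h = (if h = 0 then 1 else 0) +
      t * ((∑ i ∈ Finset.range (h + 1), q ^ i) * walkGF q t (h + 1) +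
        (∑ i ∈ Finset.range h, q ^ i) * walkGF q t (h - 1)) := by
    conv_lhs => rw [walkGF, (summable_walkGF hq ht h).tsum_eq_zero_add]
    congr 1
    · simp [walkSum]
    · rw [walkGF, walkGF, ← tsum_mul_left, ← tsum_mul_left,
        ← ((summable_walkGF hq ht _).mul_left _).tsum_add ((summable_walkGF hq ht _).mul_left _),
        ← tsum_mul_left]
      refine tsum_congr fun n => ?_
      rw [walkSum]
      ring
  rw [← mul_neg_geom_sum q h, ← mul_neg_geom_sum q (h + 1), h1]
  ring

end

/-! ### The functional equation and its solution -/

theorem summable_mul_pow_of_bounded {G : ℕ → ℂ} {C : ℝ} (hG : ∀ h, ‖G h‖ ≤ C) {x : ℂ}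
    (hx : ‖x‖ < 1) : Summable fun h => G h * x ^ h :=
  .of_norm_bounded ((summable_geometric_of_lt_one (norm_nonneg x) hx).mul_left C) fun h => by
    rw [norm_mul, norm_pow]
    gcongr
    exact hG h

/-- Multiplying the recurrence by x^(h+1) and summing turns each factor q^h into the dilation x ↦
qx. -/
theorem tsum_mul_pow_functional_equation {G : ℕ → ℂ} {C : ℝ} (hG : ∀ h, ‖G h‖ ≤ C)
    {q c : ℂ} (hq : ‖q‖ < 1)
    (hrec : ∀ h, c * (G h - if h = 0 then 1 else 0) =
      (1 - q ^ (h + 1)) * G (h + 1) + (1 - q ^ h) * G (h - 1)) {x : ℂ} (hx : ‖x‖ < 1) :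
    (1 - c * x + x ^ 2) * ∑' h, G h * x ^ h =
      (1 + q * x ^ 2) * ∑' h, G h * (q * x) ^ h - c * x := by
  have hqx : ‖q * x‖ < 1 := by
    rw [norm_mul]
    exact (mul_le_of_le_one_left (norm_nonneg _) hq.le).trans_lt hx
  have s1 := (summable_mul_pow_of_bounded hG hx).hasSum
  have s2 := (summable_mul_pow_of_bounded hG hqx).hasSum
  set A := ∑' h, G h * x ^ h
  set B := ∑' h, G h * (q * x) ^ h
  have s3 : HasSum (fun h => (1 - q ^ (h + 1)) * G (h + 1) * x ^ (h + 1)) (A - B) := by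
    have := (hasSum_nat_add_iff' 1).2 (s1.sub s2)
    simp only [Finset.range_one, Finset.sum_singleton, pow_zero, sub_self, sub_zero] at this
    refine this.congr_fun fun h => ?_
    ring
  have s4 : HasSum (fun h => (1 - q ^ h) * G (h - 1) * x ^ (h + 1))
      (x ^ 2 * A - q * x ^ 2 * B) := by
    -- The term h = 0, with its truncated index, vanishes because 1 - q^0 = 0.
    refine (hasSum_nat_add_iff' 1).1 ?_
    simp only [Finset.range_one, Finset.sum_singleton, pow_zero, sub_self, zero_mul, sub_zero]
    refine ((s1.mul_left (x ^ 2)).sub (s2.mul_left (q * x ^ 2))).congr_fun fun h => ?_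
    simp only [Nat.add_sub_cancel]
    ring
  have s5 : HasSum (fun h => c * x * (G h * x ^ h - if h = 0 then 1 else 0))
      (c * x * (A - 1)) := (s1.sub (hasSum_ite_eq 0 1)).mul_left _
  have s6 := s5.unique ((s3.add s4).congr_fun fun h => ?_)
  · linear_combination -s6
  · have := hrec h
    by_cases hh : h = 0
    · subst hh
      simp only [if_true] at this ⊢
      linear_combination x * this
    · rw [if_neg hh] at this ⊢
      linear_combination x ^ (h + 1) * this

/-- The other root is 1/z, so minimality gives |z| ≤ 1; equality would force |c| = |z + 1/z| ≤ 2. -/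
theorem norm_root_lt_one {c z : ℂ} (hc : 2 < ‖c‖) (hz : z ^ 2 - z * c + 1 = 0)
    (hmin : ∀ μ : ℂ, μ ^ 2 - μ * c + 1 = 0 → ‖z‖ ≤ ‖μ‖) : ‖z‖ < 1 := by
  have h0 : z ≠ 0 := by rintro rfl; simp at hz
  have hn : 0 < ‖z‖ := norm_pos_iff.2 h0
  have h1 := hmin z⁻¹ (by field_simp; linear_combination hz)
  rw [norm_inv, le_inv_comm₀ hn hn] at h1
  by_contra! h2
  have h3 : ‖z‖⁻¹ ≤ 1 := inv_le_one_of_one_le₀ h2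
  have h4 : ‖z‖ ≤ 1 := by rw [← inv_inv ‖z‖]; exact inv_le_one_of_one_le₀ (h2.trans h1)
  have h5 : c = z + z⁻¹ := by field_simp; linear_combination -hz
  have h6 := norm_add_le z z⁻¹
  rw [← h5, norm_inv] at h6
  linarith

theorem walkGF_zero_eq {q s t lam : ℂ} (hq : ‖q‖ < 1) (hs : s ^ 2 = q) (ht0 : t ≠ 0)
    (ht : ‖t‖ < (1 - ‖q‖) / 2) (hroot : lam ^ 2 - lam * ((1 - q) / t) + 1 = 0)
    (hlam : ‖lam‖ < 1) (ha : ‖-Complex.I * lam * s‖ < 1) (hb : ‖Complex.I * lam * s‖ < 1) :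
    walkGF q t 0 = (1 + lam ^ 2) * ∑' k, secantTerm lam s q k := by
  have hbound := norm_walkGF_le hq ht
  set A : ℂ → ℂ := fun x => ∑' h, walkGF q t h * x ^ h
  have hx : ∀ k : ℕ, ‖q ^ k * lam‖ ≤ ‖lam‖ := fun k => by
    rw [norm_mul, norm_pow]
    exact mul_le_of_le_one_left (norm_nonneg _) (pow_le_one₀ (norm_nonneg _) hq.le)
  have hfun : ∀ k : ℕ, (1 - q ^ k) * (1 - lam ^ 2 * q ^ k) * A (q ^ k * lam) =
      (1 + q * lam ^ 2 * (q ^ k) ^ 2) * A (q ^ (k + 1) * lam) - q ^ k * (1 + lam ^ 2) := by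
    intro k
    have h1 := tsum_mul_pow_functional_equation hbound (c := (1 - q) / t) hq (fun h => by
      rw [div_mul_eq_mul_div, walkGF_recurrence hq ht h, mul_div_cancel_left₀ _ ht0])
      ((hx k).trans_lt hlam)
    rw [show q * (q ^ k * lam) = q ^ (k + 1) * lam by ring] at h1
    change _ * A _ = _ * A _ - _ at h1
    generalize A (q ^ k * lam) = y at *
    generalize A (q ^ (k + 1) * lam) = y' at *
    -- Since cλ = 1 + λ², the factor 1 - cλQ + λ²Q² with Q = q^k splits as (1 - Q)(1 - λ²Q).
    linear_combination h1 + q ^ k * (y - 1) * (-hroot)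
  have hI : Complex.I ^ 2 = -1 := Complex.I_sq
  have hden : ∀ Q : ℂ, (1 - (-Complex.I * lam * s) * Q) * (1 - Complex.I * lam * s * Q) =
      1 + q * lam ^ 2 * Q ^ 2 := fun Q => by
    rw [← hs]
    linear_combination -lam ^ 2 * s ^ 2 * Q ^ 2 * hI
  have hab : (-Complex.I * lam * s) * (Complex.I * lam * s) = lam ^ 2 * q := by
    rw [← hs]
    linear_combination -lam ^ 2 * s ^ 2 * hI
  have hval : ∀ k, A (q ^ (k + 1) * lam) = (1 + lam ^ 2) *
      lambertApprox q (-Complex.I * lam * s) (Complex.I * lam * s) k := by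
    intro k
    have hne : ∀ k : ℕ, 1 + q * lam ^ 2 * (q ^ k) ^ 2 ≠ 0 := fun k => by
      rw [← hden]
      exact mul_ne_zero (one_sub_mul_pow_ne_zero hq.le ha k) (one_sub_mul_pow_ne_zero hq.le hb k)
    induction k with
    | zero =>
      -- At k = 0 the factor 1 - q^0 eliminates the unknown A(λ).
      have h1 := hfun 0
      have h2 := hden 1
      have h3 := hne 0
      simp only [mul_one, one_pow, pow_zero] at h1 h2 h3
      rw [lambertApprox, h2]
      rw [mul_one_div, eq_div_iff h3]
      linear_combination -h1
    | succ k ih =>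
      have h1 := hfun (k + 1)
      have h3 := hne (k + 1)
      rw [ih] at h1
      rw [lambertApprox, hden, hab, mul_div_assoc', eq_div_iff h3]
      linear_combination -h1
  have hlim1 := (tendsto_lambertApprox hq ha hb).const_mul (1 + lam ^ 2)
  -- Continuity of A at 0, by dominated convergence: only the constant term survives.
  have hlim2 : Filter.Tendsto (fun k : ℕ => A (q ^ (k + 1) * lam)) Filter.atTop
      (nhds (walkGF q t 0)) := by
    have h1 : Filter.Tendsto (fun k : ℕ => A (q ^ (k + 1) * lam)) Filter.atTop
        (nhds (∑' h : ℕ, if h = 0 then walkGF q t 0 else 0)) := by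
      refine tendsto_tsum_of_dominated_convergence
        (bound := fun h => (1 - 2 * (1 - ‖q‖)⁻¹ * ‖t‖)⁻¹ * ‖lam‖ ^ h)
        ((summable_geometric_of_lt_one (norm_nonneg lam) hlam).mul_left _) ?_ ?_
      · intro h
        by_cases hh : h = 0
        · simp [hh]
        · have h2 : Filter.Tendsto (fun k : ℕ => q ^ (k + 1)) Filter.atTop (nhds 0) :=
            (tendsto_pow_atTop_nhds_zero_of_norm_lt_one hq).comp (Filter.tendsto_add_atTop_nat 1)
          have h3 := ((h2.mul_const lam).pow h).const_mul (walkGF q t h)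
          rw [zero_mul, zero_pow hh, mul_zero] at h3
          rwa [if_neg hh]
      · refine Filter.Eventually.of_forall fun k h => ?_
        rw [norm_mul, norm_pow]
        gcongr
        · exact (norm_nonneg _).trans (hbound 0)
        · exact hbound h
        · exact hx (k + 1)
    rwa [tsum_ite_eq] at h1
  simp only [hval] at hlim2
  exact tendsto_nhds_unique hlim2 hlim1

/-! ### Back to path diagrams, and the infinite-slit limit -/

theorem hasSum_walkSum_even {q t : ℂ} (hq : ‖q‖ < 1) (ht : ‖t‖ < (1 - ‖q‖) / 2) :
    HasSum (fun N => walkSum q (2 * N) 0 * t ^ (2 * N)) (walkGF q t 0) := by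
  have hinj : Function.Injective fun N : ℕ => 2 * N := fun a b h => by simpa using h
  refine (hinj.hasSum_iff (f := fun n => walkSum q n 0 * t ^ n) fun n hn => ?_).2
    (summable_walkGF hq ht 0).hasSum
  rw [walkSum_eq_zero_of_odd, zero_mul]
  rw [add_zero, ← Nat.not_even_iff_odd]
  rintro ⟨m, rfl⟩
  exact hn ⟨m, two_mul m⟩

theorem summable_norm_secantCount {q t : ℂ} (hq : ‖q‖ < 1) (ht : ‖t‖ < (1 - ‖q‖) / 2) :
    Summable fun p : ℕ × ℕ => (secantCount p.1 p.2 : ℝ) * ‖t‖ ^ (2 * p.1) * ‖q‖ ^ p.2 := by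
  have hfib : ∀ N, HasSum (fun m => (secantCount N m : ℝ) * ‖t‖ ^ (2 * N) * ‖q‖ ^ m)
      (walkSum ‖q‖ (2 * N) 0 * ‖t‖ ^ (2 * N)) := fun N =>
    ((hasSum_secantCount N ‖q‖).mul_right _).congr_fun fun m => by ring
  rw [summable_prod_of_nonneg fun p => by positivity]
  refine ⟨fun N => (hfib N).summable, ?_⟩
  simp only [(hfib _).tsum_eq]
  have hq' : ‖‖q‖‖ < 1 := by rwa [norm_norm]
  have hinj : Function.Injective fun N : ℕ => 2 * N := fun a b h => by simpa using h
  refine .of_norm_bounded ((summable_geometric_of_lt_one (walkGF_ratio_nonneg hq)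
    (walk_ratio_lt_one hq ht)).comp_injective hinj) fun N => ?_
  simpa using norm_walkSum_mul_pow_le hq' ‖t‖ (2 * N) 0

theorem hasSum_secantCount_prod {q t : ℂ} (hq : ‖q‖ < 1) (ht : ‖t‖ < (1 - ‖q‖) / 2) :
    HasSum (fun p : ℕ × ℕ => (secantCount p.1 p.2 : ℂ) * t ^ (2 * p.1) * q ^ p.2)
      (walkGF q t 0) := by
  have hsum : Summable fun p : ℕ × ℕ =>
      (secantCount p.1 p.2 : ℂ) * t ^ (2 * p.1) * q ^ p.2 :=
    .of_norm_bounded (summable_norm_secantCount hq ht) fun p => by simp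
  have hfib : ∀ N, HasSum (fun m => (secantCount N m : ℂ) * t ^ (2 * N) * q ^ m)
      (walkSum q (2 * N) 0 * t ^ (2 * N)) := fun N =>
    ((hasSum_secantCount N q).mul_right _).congr_fun fun m => by ring
  rw [← (hsum.hasSum.prod_fiberwise hfib).unique (hasSum_walkSum_even hq ht)]
  exact hsum.hasSum

theorem norm_secantCountSlit_term_le (w : ℕ) (t q : ℂ) (p : ℕ × ℕ) :
    ‖(secantCountSlit w p.1 p.2 : ℂ) * t ^ (2 * p.1) * q ^ p.2‖ ≤
      (secantCount p.1 p.2 : ℝ) * ‖t‖ ^ (2 * p.1) * ‖q‖ ^ p.2 := by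
  rw [norm_mul, norm_mul, norm_pow, norm_pow, Complex.norm_natCast]
  gcongr
  exact secantCountSlit_le w p.1 p.2

/-- Each coefficient is eventually constant in w, and the unrestricted series in |t|, |q| dominates.
-/
theorem tendsto_secantSlitGF {q t : ℂ} (hq : ‖q‖ < 1) (ht : ‖t‖ < (1 - ‖q‖) / 2) :
    Filter.Tendsto (fun w => secantSlitGF w t q) Filter.atTop (nhds (walkGF q t 0)) := by
  rw [← (hasSum_secantCount_prod hq ht).tsum_eq]
  refine tendsto_tsum_of_dominated_convergence (summable_norm_secantCount hq ht) (fun p => ?_)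
    (Filter.Eventually.of_forall fun w p => norm_secantCountSlit_term_le w t q p)
  refine tendsto_const_nhds.congr' ?_
  filter_upwards [Filter.eventually_ge_atTop p.1] with w hw
  rw [secantCountSlit_eq w _ _ hw]

theorem corollary2 (q s t lam : ℂ) (hq : ‖q‖ < 1) (hs : s ^ 2 = q)
    (ht0 : t ≠ 0) (ht : ‖t‖ < (1 - ‖q‖) / 2)
    (hroot : lam ^ 2 - lam * ((1 - q) / t) + 1 = 0)
    (hmin : ∀ μ : ℂ, μ ^ 2 - μ * ((1 - q) / t) + 1 = 0 → ‖lam‖ ≤ ‖μ‖) :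
    -- the right-hand side is a convergent series with nonvanishing denominators
    (∀ k : ℕ, 1 - Complex.I * lam * s * q ^ k ≠ 0) ∧
    Summable (secantTerm lam s q) ∧
    -- the generating function of the q-secant numbers
    HasSum (fun N : ℕ => Polynomial.aeval q (qSecantNumber N) * t ^ (2 * N))
      ((1 + lam ^ 2) * ∑' k : ℕ, secantTerm lam s q k) ∧
    -- the generating function of unrestricted path diagrams
    HasSum (fun p : ℕ × ℕ => (secantCount p.1 p.2 : ℂ) * t ^ (2 * p.1) * q ^ p.2)
      ((1 + lam ^ 2) * ∑' k : ℕ, secantTerm lam s q k) ∧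
    -- the limit of infinite slit width
    (∀ w : ℕ, Summable
      (fun p : ℕ × ℕ => (secantCountSlit w p.1 p.2 : ℂ) * t ^ (2 * p.1) * q ^ p.2)) ∧
    Filter.Tendsto (fun w : ℕ => secantSlitGF w t q) Filter.atTop
      (nhds ((1 + lam ^ 2) * ∑' k : ℕ, secantTerm lam s q k)) := by
  have hc : 2 < ‖(1 - q) / t‖ := by
    have h1 := norm_sub_norm_le (1 : ℂ) q
    rw [norm_one] at h1
    rw [norm_div, lt_div_iff₀ (norm_pos_iff.2 ht0)]
    linarith
  have hlam := norm_root_lt_one hc hroot hmin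
  have hs1 : ‖s‖ ≤ 1 := by
    have h1 : ‖s‖ ^ 2 < 1 := by rwa [← norm_pow, hs]
    nlinarith [norm_nonneg s]
  have hb : ‖Complex.I * lam * s‖ < 1 := by
    rw [norm_mul, norm_mul, Complex.norm_I, one_mul]
    exact (mul_le_of_le_one_right (norm_nonneg _) hs1).trans_lt hlam
  have ha : ‖-Complex.I * lam * s‖ < 1 := by simpa using hb
  rw [← walkGF_zero_eq hq hs ht0 ht hroot hlam ha hb]
  refine ⟨one_sub_mul_pow_ne_zero hq.le hb, summable_pow_div_one_sub hq.le ha hb, ?_,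
    hasSum_secantCount_prod hq ht, fun w => .of_norm_bounded (summable_norm_secantCount hq ht)
      (norm_secantCountSlit_term_le w t q), tendsto_secantSlitGF hq ht⟩
  simpa only [aeval_qSecantNumber] using hasSum_walkSum_even hq ht
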